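/- For $c\in\mathbb{C}$ put $\eta(c)=\begin{pmatrix}c&-1\\1&0\end{pmatrix}$. Let $m\ge 4$ and let $(c_0,\dots,c_{m-1})\in\mathbb{C}^m$ be a quiddity cycle, i.e. $\eta(c_0)\eta(c_1)\cdots\eta(c_{m-1})=-I_2$, with at least one non-zero entry. Extend it $m$-periodically to $(c_k)_{k\in\mathbb{Z}}$, and let $\mathcal{F}=(c_{i,j})_{i\le j\le i+m}$ be the corresponding array, given by $c_{i,i}=0$ and $c_{i,j}=\bigl(\eta(c_i)\eta(c_{i+1})\cdots\eta(c_{j-2})\bigr)_{1,1}$ for $i<j\le i+m$ (the empty product being $I_2$). Then $\mathcal{F}$ is a tame frieze pattern of height $n=m-3$; that is, $c_{i,i}=c_{i,i+m}=0$ and $c_{i,i+1}=c_{i,i+m-1}=1$ for all $i\in\mathbb{Z}$, every $2\times2$ block of adjacent rows and columns lying completely in the array has determinant $1$, and every such $3\times 3$ block has determinant $0$. Moreover, $\mathcal{F}$ contains a cluster without zero entry: there is a maximal set $T$ of pairwise non-crossing diagonals (i.e. a triangulation) of the convex $m$-gon with vertices labelled $0,\dots,m-1$ in cyclic order such that $c_{i,j}\ne0$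 for every diagonal $(i,j)\in T$, $i<j$. In particular, $\mathcal{F}$ is a specialization of the cluster algebra of Dynkin type $A_{m-3}$; here a tame frieze pattern over $\mathbb{C}$ of height $n$ is called a specialization of the cluster algebra of Dynkin type $A_n$ if it contains a cluster with only non-zero entries, i.e. if its entries at the positions $(i,j)$, $0\le i<j\le n+2$, given by the diagonals of some triangulation of the $(n+3)$-gon are all non-zero. -/

import Mathlib

/-- The matrix `η(c) = (c, -1; 1, 0)`. -/
def eta (c : ℂ) : Matrix (Fin 2) (Fin 2) ℂ := !![c, -1; 1, 0]

/-- `c` is a quiddity cycle: `η(c₀) η(c₁) ⋯ η(c_{m-1}) = -1` (ordered product). -/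
def IsQuiddityCycle {m : ℕ} (c : Fin m → ℂ) : Prop :=
  (List.ofFn fun k => eta (c k)).prod = !![-1, 0; 0, -1]

/-- The `m`-periodic extension of `(c₀, …, c_{m-1})` to all integer indices. -/
def periodicExt {m : ℕ} [NeZero m] (c : Fin m → ℂ) (k : ℤ) : ℂ :=
  c (Fin.ofNat m (k % (m : ℤ)).toNat)

/-- `M_{i,j} = η(c_i) η(c_{i+1}) ⋯ η(c_j)`, the identity matrix if `j < i`. -/
def etaProd (c : ℤ → ℂ) (i j : ℤ) : Matrix (Fin 2) (Fin 2) ℂ :=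
  ((List.range (j + 1 - i).toNat).map fun k => eta (c (i + (k : ℤ)))).prod

/-- The array is stored as a function on `ℤ × ℤ`; only the entries in the strip
`i ≤ j ≤ i + n + 3` belong to the pattern, and the values outside play no role.
The strip is bounded by diagonals of zeros and ones, and every `2 × 2` block of adjacent
rows and columns lying completely in the strip has determinant `1`. -/
structure IsFriezePattern (n : ℕ) (F : ℤ → ℤ → ℂ) : Prop where
  zero_left : ∀ i, F i i = 0
  one_left : ∀ i, F i (i + 1) = 1
  one_right : ∀ i, F i (i + n + 2) = 1
  zero_right : ∀ i, F i (i + n + 3) = 0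
  det_two : ∀ i j : ℤ, i + 1 ≤ j → j + 1 ≤ i + n + 3 →
    Matrix.det !![F i j, F i (j + 1);
                  F (i + 1) j, F (i + 1) (j + 1)] = 1

/-- Every `3 × 3` block of adjacent rows and columns lying completely in the strip
has determinant `0`. -/
def IsTame (n : ℕ) (F : ℤ → ℤ → ℂ) : Prop :=
  ∀ i j : ℤ, i + 2 ≤ j → j + 2 ≤ i + n + 3 →
    Matrix.det !![F i j, F i (j + 1), F i (j + 2);
                  F (i + 1) j, F (i + 1) (j + 1), F (i + 1) (j + 2);
                  F (i + 2) j, F (i + 2) (j + 1), F (i + 2) (j + 2)] = 0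

/-- The array attached to a quiddity cycle: the entry at `(i, j)` with `i < j` is the upper left
entry of `M_{i, j-2}`; the diagonal `j = i` is the bounding diagonal of zeros. -/
noncomputable def friezeOf {m : ℕ} [NeZero m] (c : Fin m → ℂ) (i j : ℤ) : ℂ :=
  if i < j then etaProd (periodicExt c) i (j - 2) 0 0 else 0

/-- A diagonal of the `m`-gon with vertices `0, …, m - 1` in cyclic order: a pair `i < j` of
vertices that are not neighbours. -/
def IsDiagonal (m : ℕ) (d : ℕ × ℕ) : Prop :=
  d.2 < m ∧ d.1 + 1 < d.2 ∧ ¬ (d.1 = 0 ∧ d.2 + 1 = m)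

/-- Two diagonals cross (in their interiors): their endpoints strictly interlace. -/
def Crosses (d e : ℕ × ℕ) : Prop :=
  (d.1 < e.1 ∧ e.1 < d.2 ∧ d.2 < e.2) ∨ (e.1 < d.1 ∧ d.1 < e.2 ∧ e.2 < d.2)

/-- A set of pairwise non-crossing diagonals of the `m`-gon. -/
def IsNoncrossing (m : ℕ) (T : Finset (ℕ × ℕ)) : Prop :=
  (∀ d ∈ T, IsDiagonal m d) ∧ ∀ d ∈ T, ∀ e ∈ T, ¬ Crosses d e

/-- A cluster (triangulation) of the `m`-gon: a set of pairwise non-crossing diagonals that is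
maximal with respect to inclusion. -/
def IsCluster (m : ℕ) (T : Finset (ℕ × ℕ)) : Prop :=
  Maximal (IsNoncrossing m) T

/-- All entries of `F` at the positions of `T` are non-zero. -/
def NonzeroOn (F : ℤ → ℤ → ℂ) (T : Finset (ℕ × ℕ)) : Prop :=
  ∀ d ∈ T, F (d.1 : ℤ) (d.2 : ℤ) ≠ 0

/-- `F` is a specialization of the cluster algebra of Dynkin type `A_n`: a tame frieze pattern
of height `n` that contains a cluster with only non-zero entries (so that the indeterminates
placed on this cluster can be specialized to these entries). -/
def IsSpecialization (n : ℕ) (F : ℤ → ℤ → ℂ) : Prop :=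
  IsFriezePattern n F ∧ IsTame n F ∧ ∃ T, IsCluster (n + 3) T ∧ NonzeroOn F T

/-! ### Ordered products of the matrices `η(c)` -/

/-! Let `v_j` be the second column of `M_{0,j-1}`. The entries `c_{i,j}` are the 2×2 determinants
`det(v_i, v_j)`, so for `0 ≤ i < j` an entry vanishes exactly when `v_i` and `v_j` span the same
point of the projective line (`friezePoint_eq_iff`). The period product `-1` makes these points
`m`-periodic; as `c_{i,i+1} = 1`, they properly colour the vertices of the `m`-gon, and `c_k =
c_{k,k+2} ≠ 0` yields three colours. What remains is combinatorial (`exists_cluster_of_coloring`): a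
proper colouring with at least three colours admits a triangulation with no monochromatic diagonal.
Take an ear whose base has two colours. If its tip has a unique colour, the fan at the tip works;
otherwise cutting the ear off keeps three colours, and induction applies. -/

theorem eta_det (c : ℂ) : (eta c).det = 1 := by
  simp [eta, Matrix.det_fin_two_of]

/-- The body of `etaProd` elaborates with the whole list coerced to integers through the list monad;
here the cast is moved back inside the map. -/
theorem etaProd_eq_prod_map (c : ℤ → ℂ) (i j : ℤ) :
    etaProd c i j = ((List.range (j + 1 - i).toNat).map fun k : ℕ => eta (c (i + (k : ℤ)))).prod := by
  unfold etaProd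
  congr 1
  simp only [List.bind_eq_flatMap, List.pure_def, List.map_flatMap, List.map_cons, List.map_nil]
  exact List.flatMap_pure_eq_map _ _

theorem etaProd_of_lt (c : ℤ → ℂ) {i j : ℤ} (h : j < i) : etaProd c i j = 1 := by
  have : (j + 1 - i).toNat = 0 := by omega
  simp [etaProd, this]

theorem etaProd_succ_right (c : ℤ → ℂ) {i j : ℤ} (h : i ≤ j + 1) :
    etaProd c i (j + 1) = etaProd c i j * eta (c (j + 1)) := by
  have h1 : (j + 1 + 1 - i).toNat = (j + 1 - i).toNat + 1 := by omega
  have h2 : i + ((j + 1 - i).toNat : ℤ) = j + 1 := by omega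
  simp only [etaProd_eq_prod_map, h1, List.range_succ, List.map_append, List.prod_append, List.map_cons,
    List.map_nil, List.prod_cons, List.prod_nil, mul_one, h2]

theorem etaProd_mul (c : ℤ → ℂ) {i k j : ℤ} (hik : i ≤ k + 1) (hkj : k ≤ j) :
    etaProd c i k * etaProd c (k + 1) j = etaProd c i j := by
  induction j, hkj using Int.leInduction with
  | base => rw [etaProd_of_lt c (by omega : k < k + 1), mul_one]
  | succ j hj ih =>
    rw [etaProd_succ_right c (by omega : k + 1 ≤ j + 1),
      etaProd_succ_right c (by omega : i ≤ j + 1), ← mul_assoc, ih]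

theorem etaProd_self (c : ℤ → ℂ) (i : ℤ) : etaProd c i i = eta (c i) := by
  simp [etaProd]

theorem etaProd_succ_left (c : ℤ → ℂ) {i j : ℤ} (h : i ≤ j) :
    etaProd c i j = eta (c i) * etaProd c (i + 1) j := by
  rw [← etaProd_self, etaProd_mul c (by omega) h]

theorem etaProd_det (c : ℤ → ℂ) (i j : ℤ) : (etaProd c i j).det = 1 := by
  rcases lt_or_ge j i with h | h
  · simp [etaProd_of_lt c h]
  · induction j, h using Int.leInduction with
    | base => rw [etaProd_self, eta_det]
    | succ j hj ih => rw [etaProd_succ_right c (by omega), Matrix.det_mul, ih, eta_det, mul_one]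

/-! ### The array attached to a periodic sequence -/

section Frieze

variable {m : ℕ} [NeZero m] (c : Fin m → ℂ)

theorem periodicExt_add (k : ℤ) : periodicExt c (k + m) = periodicExt c k := by
  simp [periodicExt]

theorem periodicExt_natCast (k : Fin m) : periodicExt c (k : ℕ) = c k := by
  have h : (((k : ℕ) : ℤ) % (m : ℤ)).toNat = k := by
    rw [← Int.natCast_mod, Int.toNat_natCast, Nat.mod_eq_of_lt k.isLt]
  simp [periodicExt, h]

theorem friezeOf_of_lt {i j : ℤ} (h : i < j) :
    friezeOf c i j = etaProd (periodicExt c) i (j - 2) 0 0 := by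
  simp [friezeOf, h]

theorem friezeOf_self (i : ℤ) : friezeOf c i i = 0 := by
  simp [friezeOf]

theorem friezeOf_succ (i : ℤ) : friezeOf c i (i + 1) = 1 := by
  rw [friezeOf_of_lt c (by omega), etaProd_of_lt _ (by omega)]
  simp

theorem friezeOf_add_two (i : ℤ) : friezeOf c i (i + 2) = periodicExt c i := by
  rw [friezeOf_of_lt c (by omega), add_sub_cancel_right, etaProd_self]
  simp [eta]

/-- The entries of a product `η(c_i) ⋯ η(c_{j-1})` form a block of adjacent rows and columns. -/
theorem etaProd_eq_friezeOf {i j : ℤ} (h : i + 1 ≤ j) :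
    etaProd (periodicExt c) i (j - 1) =
      !![friezeOf c i (j + 1), -friezeOf c i j;
         friezeOf c (i + 1) (j + 1), -friezeOf c (i + 1) j] := by
  have e1 : j + 1 - 2 = j - 1 := by ring
  have e2 : j - 2 + 1 = j - 1 := by ring
  have hr : ∀ i' : ℤ, i' ≤ j - 1 → etaProd (periodicExt c) i' (j - 1) =
      etaProd (periodicExt c) i' (j - 2) * eta (periodicExt c (j - 1)) := by
    intro i' hi'
    rw [← e2, etaProd_succ_right _ (by omega)]
  ext a b
  fin_cases a <;> fin_cases b
  · simp [friezeOf_of_lt c (by omega : i < j + 1), e1]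
  · simp [friezeOf_of_lt c (by omega : i < j), hr i (by omega), eta, Matrix.mul_apply,
      Fin.sum_univ_two]
  · simp [friezeOf_of_lt c (by omega : i + 1 < j + 1), e1,
      etaProd_succ_left _ (by omega : i ≤ j - 1), eta, Matrix.mul_apply, Fin.sum_univ_two]
  · rcases eq_or_lt_of_le h with rfl | h
    · simp [friezeOf_self, etaProd_self, eta]
    · simp [friezeOf_of_lt c h, etaProd_succ_left _ (by omega : i ≤ j - 1), hr (i + 1) (by omega),
        eta, Matrix.mul_apply, Fin.sum_univ_two]

theorem friezeOf_det_two {i j : ℤ} (h : i + 1 ≤ j) :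
    friezeOf c i j * friezeOf c (i + 1) (j + 1) -
      friezeOf c i (j + 1) * friezeOf c (i + 1) j = 1 := by
  have := etaProd_det (periodicExt c) i (j - 1)
  rw [etaProd_eq_friezeOf c h, Matrix.det_fin_two_of] at this
  linear_combination this

/-- Three consecutive rows satisfy a three-term recursion. -/
theorem friezeOf_row {i j : ℤ} (h : i + 2 ≤ j) :
    friezeOf c i j = periodicExt c i * friezeOf c (i + 1) j - friezeOf c (i + 2) j := by
  rcases eq_or_lt_of_le h with rfl | h'
  · rw [friezeOf_add_two, friezeOf_self, show i + 2 = i + 1 + 1 by ring, friezeOf_succ]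
    ring
  · have h1 := etaProd_eq_friezeOf c (by omega : i + 1 ≤ j)
    have h2 := etaProd_eq_friezeOf c (by omega : i + 1 + 1 ≤ j)
    rw [etaProd_succ_left _ (by omega : i ≤ j - 1), h2] at h1
    have := congrFun (congrFun h1 0) 1
    simp [eta, add_assoc, one_add_one_eq_two] at this
    linear_combination this

/-- By `friezeOf_row` the first row of each block is a combination of the other two, with
coefficients independent of the column. -/
theorem friezeOf_isTame (n : ℕ) : IsTame n (friezeOf c) := by
  intro i j h _
  rw [Matrix.det_fin_three]
  simp only [Matrix.of_apply, Matrix.cons_val', Matrix.cons_val_zero, Matrix.cons_val_one,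
    Matrix.cons_val]
  rw [friezeOf_row c h, friezeOf_row c (by omega : i + 2 ≤ j + 1),
    friezeOf_row c (by omega : i + 2 ≤ j + 2)]
  ring

variable {c}

/-- The product over one period is `-1`, wherever the period starts. -/
theorem IsQuiddityCycle.etaProd_period (hc : IsQuiddityCycle c) (i : ℤ) :
    etaProd (periodicExt c) i (i + m - 1) = -1 := by
  have hm : (0 : ℤ) < m := by exact_mod_cast Nat.pos_of_ne_zero (NeZero.ne m)
  -- Shifting the start of the period conjugates the product by an invertible matrix, and `-1` is
  -- central.
  have step : ∀ i : ℤ, eta (periodicExt c i) * etaProd (periodicExt c) (i + 1) (i + 1 + m - 1) =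
      etaProd (periodicExt c) i (i + m - 1) * eta (periodicExt c i) := by
    intro i
    rw [show i + 1 + (m : ℤ) - 1 = i + m - 1 + 1 by ring, ← etaProd_succ_left _ (by omega),
      etaProd_succ_right _ (by omega), sub_add_cancel, periodicExt_add]
  have hu : ∀ a, IsUnit (eta a) := fun a => by
    rw [Matrix.isUnit_iff_isUnit_det, eta_det]; exact isUnit_one
  induction i with
  | zero =>
    have h1 : (0 + (m : ℤ) - 1 + 1 - 0).toNat = m := by omega
    have h2 : (-1 : Matrix (Fin 2) (Fin 2) ℂ) = !![-1, 0; 0, -1] := by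
      ext a b; fin_cases a <;> fin_cases b <;> simp
    rw [h2, ← hc, etaProd_eq_prod_map, h1]
    congr 1
    apply List.ext_getElem
    · simp
    · intro k hk _
      have hk' : k < m := by simpa using hk
      simpa using congrArg eta (periodicExt_natCast c ⟨k, hk'⟩)
  | succ i ih =>
    have := step i
    rw [ih] at this
    apply (hu (periodicExt c i)).mul_left_cancel
    rw [this]; simp
  | pred i ih =>
    have := step (-i - 1)
    rw [sub_add_cancel, ih] at this
    apply (hu (periodicExt c (-i - 1))).mul_right_cancel
    rw [← this]; simp

/-- The right boundary is the second column of the period product `-1`, read through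
`etaProd_eq_friezeOf`. -/
theorem IsQuiddityCycle.isFriezePattern (hc : IsQuiddityCycle c) (hm : 4 ≤ m) :
    IsFriezePattern (m - 3) (friezeOf c) := by
  have key (i : ℤ) := (etaProd_eq_friezeOf c (by omega : i + 1 ≤ i + m)).symm.trans
    (hc.etaProd_period i)
  have hn : ((m - 3 : ℕ) : ℤ) = m - 3 := by omega
  refine ⟨friezeOf_self c, friezeOf_succ c, fun i => ?_, fun i => ?_, fun i j h _ => ?_⟩
  · have := congrFun (congrFun (key (i - 1)) 1) 1
    rw [hn, show i + ((m : ℤ) - 3) + 2 = i - 1 + m by ring]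
    simpa using this
  · have := congrFun (congrFun (key i) 0) 1
    rw [hn, show i + ((m : ℤ) - 3) + 3 = i + m by ring]
    simpa using this
  · rw [Matrix.det_fin_two_of]
    exact friezeOf_det_two c h

end Frieze

/-! ### Points on the projective line -/

/-- The point `[x : y]` of the projective line, with `none` as the point at infinity. -/
noncomputable def projPoint (x y : ℂ) : Option ℂ :=
  open Classical in if y = 0 then none else some (x / y)

theorem projPoint_neg (x y : ℂ) : projPoint (-x) (-y) = projPoint x y := by
  simp [projPoint]

theorem projPoint_eq_iff {x y x' y' : ℂ} (h : x ≠ 0 ∨ y ≠ 0) (h' : x' ≠ 0 ∨ y' ≠ 0) :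
    projPoint x y = projPoint x' y' ↔ x * y' - y * x' = 0 := by
  unfold projPoint
  by_cases hy : y = 0 <;> by_cases hy' : y' = 0
  · simp [hy, hy']
  · simp_all
  · simp_all
  · simp only [hy, hy', if_false, Option.some.injEq]
    rw [div_eq_div_iff hy hy', sub_eq_zero, mul_comm y x']

section Points

variable {m : ℕ} [NeZero m] (c : Fin m → ℂ)

/-- The points of the projective line whose Plücker coordinates are the entries of the frieze. -/
noncomputable def friezePoint (j : ℕ) : Option ℂ :=
  projPoint (etaProd (periodicExt c) 0 (j - 1) 0 1) (etaProd (periodicExt c) 0 (j - 1) 1 1)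

/-- Let `u, v` be the columns of `M_{0,i-1}`, so `det(u, v) = 1`. The second column of `M_{0,j-1}`
is minus the first column of `M_{0,i-1} M_{i,j-2}`, that is `-(c_{i,j} u + b v)` for some `b`; its
determinant with `v` is `c_{i,j}`. -/
theorem friezePoint_eq_iff {i j : ℕ} (h : i < j) :
    friezePoint c i = friezePoint c j ↔ friezeOf c i j = 0 := by
  have hd (k : ℤ) := etaProd_det (periodicExt c) 0 k
  have hne (k : ℤ) : etaProd (periodicExt c) 0 k 0 1 ≠ 0 ∨ etaProd (periodicExt c) 0 k 1 1 ≠ 0 := by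
    by_contra! hk
    have := hd k
    rw [Matrix.det_fin_two, hk.1, hk.2] at this
    simp at this
  have e1 : (j : ℤ) - 2 + 1 = j - 1 := by ring
  have hs := etaProd_succ_right (periodicExt c) (by omega : (0 : ℤ) ≤ (j : ℤ) - 2 + 1)
  rw [e1] at hs
  have hp := etaProd_mul (periodicExt c) (by omega : (0 : ℤ) ≤ (i : ℤ) - 1 + 1)
    (by omega : (i : ℤ) - 1 ≤ j - 2)
  rw [sub_add_cancel] at hp
  have h00 := congrFun (congrFun hp 0) 0
  have h10 := congrFun (congrFun hp 1) 0
  have hdi := hd ((i : ℤ) - 1)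
  rw [Matrix.det_fin_two] at hdi
  rw [friezePoint, friezePoint, projPoint_eq_iff (hne _) (hne _), hs, friezeOf_of_lt c (by omega)]
  simp only [Matrix.mul_apply, Fin.sum_univ_two] at h00 h10 ⊢
  rw [← h00, ← h10]
  simp only [eta, Matrix.of_apply, Matrix.cons_val', Matrix.cons_val_zero, Matrix.cons_val_one,
    Matrix.cons_val_fin_one, mul_zero, add_zero, mul_neg, mul_one]
  refine Eq.congr_left ?_
  linear_combination (etaProd (periodicExt c) i (j - 2) 0 0) * hdi

variable {c}

theorem IsQuiddityCycle.friezePoint_periodic (hc : IsQuiddityCycle c) :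
    Function.Periodic (friezePoint c) m := by
  intro j
  have hp := etaProd_mul (periodicExt c) (by omega : (0 : ℤ) ≤ (j : ℤ) - 1 + 1)
    (by omega : (j : ℤ) - 1 ≤ j + m - 1)
  rw [sub_add_cancel, hc.etaProd_period, mul_neg, mul_one] at hp
  rw [friezePoint, Nat.cast_add, ← hp, Matrix.neg_apply, Matrix.neg_apply, projPoint_neg,
    friezePoint]

theorem friezePoint_ne_succ (j : ℕ) : friezePoint c j ≠ friezePoint c (j + 1) := by
  rw [Ne, friezePoint_eq_iff c (by omega), Nat.cast_succ, friezeOf_succ]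
  exact one_ne_zero

end Points

/-! ### Triangulations of a polygon with coloured vertices -/

/-- A set of non-crossing diagonals is a cluster if every further diagonal crosses it. -/
theorem isCluster_of_crosses {m : ℕ} {T : Finset (ℕ × ℕ)} (hT : IsNoncrossing m T)
    (h : ∀ d, IsDiagonal m d → d ∉ T → ∃ e ∈ T, Crosses d e) : IsCluster m T := by
  refine ⟨hT, fun S hS hTS d hd => ?_⟩
  by_contra hdT
  obtain ⟨e, he, hde⟩ := h d (hS.1 d hd) hdT
  exact hS.2 d hd e (hTS he) hde

theorem IsCluster.exists_crosses {m : ℕ} {T : Finset (ℕ × ℕ)} (hT : IsCluster m T)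
    {d : ℕ × ℕ} (hd : IsDiagonal m d) (hdT : d ∉ T) : ∃ e ∈ T, Crosses d e := by
  by_contra! hno
  have hsymm : ∀ {e : ℕ × ℕ}, Crosses e d → Crosses d e := fun h => Or.symm h
  have hS : IsNoncrossing m (insert d T) := by
    refine ⟨fun e he => ?_, fun e he f hf => ?_⟩
    · rcases Finset.mem_insert.1 he with rfl | he
      exacts [hd, hT.prop.1 e he]
    · rcases Finset.mem_insert.1 he with rfl | he' <;>
        rcases Finset.mem_insert.1 hf with rfl | hf'
      · unfold Crosses; omega
      · exact hno f hf'
      · exact fun h => hno e he' (hsymm h)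
      · exact hT.prop.2 e he' f hf'
  exact hdT (hT.2 hS (Finset.subset_insert d T) (Finset.mem_insert_self d T))

instance (m : ℕ) : DecidablePred (IsDiagonal m) := fun d =>
  inferInstanceAs (Decidable (d.2 < m ∧ d.1 + 1 < d.2 ∧ ¬ (d.1 = 0 ∧ d.2 + 1 = m)))

/-- The fan at the vertex `k`: all diagonals of the `m`-gon with endpoint `k`. -/
def fan (m k : ℕ) : Finset (ℕ × ℕ) :=
  {d ∈ Finset.range m ×ˢ Finset.range m | IsDiagonal m d ∧ (d.1 = k ∨ d.2 = k)}

theorem mem_fan {m k : ℕ} {d : ℕ × ℕ} :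
    d ∈ fan m k ↔ IsDiagonal m d ∧ (d.1 = k ∨ d.2 = k) := by
  rw [fan, Finset.mem_filter, Finset.mem_product, Finset.mem_range, Finset.mem_range]
  unfold IsDiagonal
  omega

theorem isCluster_fan {m k : ℕ} (hk : k < m) : IsCluster m (fan m k) := by
  refine isCluster_of_crosses ⟨fun d hd => (mem_fan.1 hd).1, fun d hd e he => ?_⟩ ?_
  · have := mem_fan.1 hd
    have := mem_fan.1 he
    unfold Crosses
    omega
  · rintro ⟨a, b⟩ hd hdT
    rw [mem_fan] at hdT
    have hw : ∀ x y, IsDiagonal m (x, y) → (x = k ∨ y = k) → Crosses (a, b) (x, y) →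
        ∃ e ∈ fan m k, Crosses (a, b) e := fun x y h1 h2 h3 => ⟨(x, y), mem_fan.2 ⟨h1, h2⟩, h3⟩
    simp only [IsDiagonal, Crosses] at *
    -- The crossing diagonal joins `k` to a vertex on the other side of `(a, b)`: `a + 1` if `k` is
    -- outside `[a, b]`, otherwise `m - 1` or `0`.
    rcases lt_or_ge k a with h | h
    · exact hw k (a + 1) (by omega) (by omega) (by omega)
    rcases lt_or_ge b k with h' | h'
    · exact hw (a + 1) k (by omega) (by omega) (by omega)
    by_cases h0 : a = 0
    · exact hw k (m - 1) (by omega) (by omega) (by omega)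
    · exact hw 0 k (by omega) (by omega) (by omega)

/-- The increasing enumeration of the natural numbers different from `k`. -/
def skip (k i : ℕ) : ℕ := if i < k then i else i + 1

theorem skip_eq_cases (k i : ℕ) : (i < k ∧ skip k i = i) ∨ (k ≤ i ∧ skip k i = i + 1) := by
  unfold skip; split <;> omega

/-- Gluing an ear with tip `k` to a triangulated polygon. -/
theorem IsCluster.insert_ear {m k : ℕ} {T : Finset (ℕ × ℕ)} (hT : IsCluster m T) (hm : 3 ≤ m)
    (hk : 0 < k) (hkm : k < m) :
    IsCluster (m + 1) (insert (k - 1, k + 1) (T.image (Prod.map (skip k) (skip k)))) := by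
  have hs := skip_eq_cases k
  have hcr : ∀ d e : ℕ × ℕ, Crosses (Prod.map (skip k) (skip k) d)
      (Prod.map (skip k) (skip k) e) ↔ Crosses d e := by
    intro d e
    have := hs d.1; have := hs d.2; have := hs e.1; have := hs e.2
    simp only [Crosses, Prod.map_fst, Prod.map_snd]
    omega
  have hear : ∀ d ∈ T, ¬ Crosses (k - 1, k + 1) (Prod.map (skip k) (skip k) d) ∧
      ¬ Crosses (Prod.map (skip k) (skip k) d) (k - 1, k + 1) := by
    intro d _
    have := hs d.1; have := hs d.2
    simp only [Crosses, Prod.map_fst, Prod.map_snd]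
    omega
  refine isCluster_of_crosses ⟨?_, ?_⟩ ?_
  · simp only [Finset.mem_insert, Finset.mem_image]
    rintro _ (rfl | ⟨d, hd, rfl⟩)
    · simp only [IsDiagonal]; omega
    · have := hT.prop.1 d hd
      have := hs d.1; have := hs d.2
      simp only [IsDiagonal, Prod.map_fst, Prod.map_snd] at *
      omega
  · simp only [Finset.mem_insert, Finset.mem_image]
    rintro _ (rfl | ⟨d, hd, rfl⟩) _ (rfl | ⟨e, he, rfl⟩)
    · simp only [Crosses]; omega
    · exact (hear e he).1
    · exact (hear d hd).2
    · rw [hcr]; exact hT.prop.2 d hd e he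
  · rintro ⟨a, b⟩ hd hdT
    simp only [Finset.mem_insert, Finset.mem_image, not_or, not_exists, not_and] at hdT
    by_cases hak : a = k ∨ b = k
    · refine ⟨_, Finset.mem_insert_self _ _, ?_⟩
      simp only [IsDiagonal, Crosses] at *
      omega
    · have hsur : ∀ x, x ≠ k → ∃ y, skip k y = x := by
        intro x hx
        rcases lt_or_gt_of_ne hx with h | h
        · exact ⟨x, by have := hs x; omega⟩
        · exact ⟨x - 1, by have := hs (x - 1); omega⟩
      obtain ⟨a', rfl⟩ := hsur a (by omega)
      obtain ⟨b', rfl⟩ := hsur b (by omega)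
      -- Only the base of the ear would become an edge of the smaller polygon.
      have hne : ¬ (skip k a' = k - 1 ∧ skip k b' = k + 1) := by simpa using hdT.1
      have hd' : IsDiagonal m (a', b') := by
        have := hs a'; have := hs b'
        simp only [IsDiagonal] at *
        omega
      obtain ⟨e, he, hce⟩ := hT.exists_crosses hd' fun h => hdT.2 _ h rfl
      exact ⟨_, Finset.mem_insert_of_mem (Finset.mem_image_of_mem _ he), (hcr (a', b') e).2 hce⟩

/-- A sequence with at least three values takes distinct values at some positions `k`, `k + 2`. -/
theorem exists_ne_add_two {α : Type*} {m : ℕ} {p : ℕ → α} {x y z : ℕ} (hx : x < m) (hy : y < m)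
    (hz : z < m) (hxy : p x ≠ p y) (hyz : p y ≠ p z) (hxz : p x ≠ p z) :
    ∃ k, k + 2 < m ∧ p k ≠ p (k + 2) := by
  -- Otherwise `p` depends only on parity and takes at most two values.
  by_contra! h
  have hmod : ∀ i, i < m → p i = p (i % 2) := by
    intro i
    induction i using Nat.strong_induction_on with
    | _ i ih =>
      intro hi
      by_cases h2 : i < 2
      · rw [Nat.mod_eq_of_lt h2]
      · obtain ⟨j, rfl⟩ : ∃ j, i = j + 2 := ⟨i - 2, by omega⟩
        rw [← h j hi, ih j (by omega) (by omega), Nat.add_mod_right]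
  rw [hmod x hx] at hxy hxz
  rw [hmod y hy] at hxy hyz
  rw [hmod z hz] at hyz hxz
  rcases Nat.mod_two_eq_zero_or_one x with h1 | h1 <;>
  rcases Nat.mod_two_eq_zero_or_one y with h2 | h2 <;>
  rcases Nat.mod_two_eq_zero_or_one z with h3 | h3 <;> simp_all

/-- A polygon whose vertices are properly coloured with at least three colours has a triangulation
all of whose diagonals join vertices of different colours. -/
theorem exists_cluster_of_coloring {α : Type*} (m : ℕ) (p : ℕ → α)
    (hadj : ∀ i, i + 1 < m → p i ≠ p (i + 1)) (hend : p 0 ≠ p (m - 1))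
    (hthree : ∃ x < m, ∃ y < m, ∃ z < m, p x ≠ p y ∧ p y ≠ p z ∧ p x ≠ p z) :
    ∃ T, IsCluster m T ∧ ∀ d ∈ T, p d.1 ≠ p d.2 := by
  induction m generalizing p with
  | zero => obtain ⟨x, hx, -⟩ := hthree; omega
  | succ m ih =>
    obtain ⟨x, hx, y, hy, z, hz, hxy, hyz, hxz⟩ := hthree
    obtain ⟨l, hl, hne⟩ := exists_ne_add_two hx hy hz hxy hyz hxz
    by_cases huniq : ∀ j, j < m + 1 → p j = p (l + 1) → j = l + 1
    · refine ⟨fan (m + 1) (l + 1), isCluster_fan (by omega), fun d hd heq => ?_⟩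
      obtain ⟨⟨h1, h2, -⟩, h3 | h3⟩ := mem_fan.1 hd
      · have := huniq d.2 h1 (by rw [← heq, h3])
        omega
      · have := huniq d.1 (by omega) (by rw [heq, h3])
        omega
    · push Not at huniq
      -- The vertex `j` survives the removal of `l + 1` and carries its colour, so three colours
      -- remain.
      obtain ⟨j, hj, hpj, hjl⟩ := huniq
      have hl1 := hadj l (by omega)
      have hl2 := hadj (l + 1) (by omega)
      have hjl0 : j ≠ l := fun h => hl1 (h ▸ hpj)
      have hjl2 : j ≠ l + 2 := fun h => hl2 (h ▸ hpj).symm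
      have hs := skip_eq_cases (l + 1)
      have hsl : skip (l + 1) l = l := by have := hs l; omega
      have hsl' : skip (l + 1) (l + 1) = l + 2 := by have := hs (l + 1); omega
      have hlift : ∀ i < m + 1, i ≠ l + 1 → ∃ i' < m, p (skip (l + 1) i') = p i := by
        intro i hi hil
        rcases lt_or_gt_of_ne hil with h | h
        · exact ⟨i, by omega, congrArg p (by have := hs i; omega)⟩
        · exact ⟨i - 1, by omega, congrArg p (by have := hs (i - 1); omega)⟩
      obtain ⟨j', hj', hpj'⟩ := hlift j hj hjl
      obtain ⟨T, hT, hTp⟩ := ih (fun i => p (skip (l + 1) i))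
        (by
          intro i hi
          by_cases hil : i = l
          · subst hil
            simpa only [hsl, hsl'] using hne
          · have : skip (l + 1) (i + 1) = skip (l + 1) i + 1 := by
              have := hs i; have := hs (i + 1); omega
            simp only [this]
            exact hadj _ (by have := hs i; omega))
        (by
          have h0 : skip (l + 1) 0 = 0 := by have := hs 0; omega
          have h1 : skip (l + 1) (m - 1) = m := by have := hs (m - 1); omega
          simpa only [h0, h1, Nat.add_sub_cancel] using hend)
        ⟨l, by omega, j', hj', l + 1, by omega, by rw [hsl, hpj', hpj]; exact hl1,
          by rw [hsl', hpj', hpj]; exact hl2, by rw [hsl, hsl']; exact hne⟩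
      refine ⟨_, hT.insert_ear (by omega) (by omega : 0 < l + 1) (by omega), ?_⟩
      simp only [Finset.mem_insert, Finset.mem_image]
      rintro _ (rfl | ⟨d, hd, rfl⟩)
      · exact hne
      · exact hTp d hd

/-! ### The main theorem -/

theorem IsQuiddityCycle.exists_cluster {m : ℕ} [NeZero m] {c : Fin m → ℂ}
    (hc : IsQuiddityCycle c) (hne : ∃ k, c k ≠ 0) :
    ∃ T, IsCluster m T ∧ NonzeroOn (friezeOf c) T := by
  have hm : 0 < m := Nat.pos_of_ne_zero (NeZero.ne m)
  obtain ⟨k, hk⟩ := hne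
  have hper := hc.friezePoint_periodic
  have hk2 : friezePoint c k ≠ friezePoint c (k + 2) := by
    rw [Ne, friezePoint_eq_iff c (by omega), Nat.cast_add, Nat.cast_two, friezeOf_add_two,
      periodicExt_natCast]
    exact hk
  obtain ⟨T, hT, hTp⟩ := exists_cluster_of_coloring m (friezePoint c)
    (fun i _ => friezePoint_ne_succ i)
    (by
      have h1 := friezePoint_ne_succ (c := c) (m - 1)
      have h2 := hper 0
      rw [Nat.sub_add_cancel hm] at h1
      rw [zero_add] at h2
      rw [← h2]
      exact h1.symm)
    -- Reduction modulo `m` is needed since `k + 1` and `k + 2` may pass the last vertex.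
    ⟨k % m, Nat.mod_lt _ hm, (k + 1) % m, Nat.mod_lt _ hm, (k + 2) % m, Nat.mod_lt _ hm, by
      simp only [hper.map_mod_nat]
      exact ⟨friezePoint_ne_succ _, friezePoint_ne_succ _, hk2⟩⟩
  refine ⟨T, hT, fun d hd h0 => hTp d hd ?_⟩
  have := (hT.prop.1 d hd).2.1
  exact (friezePoint_eq_iff c (by omega)).2 h0

theorem mainTheorem5 (m : ℕ) [NeZero m] (hm : 4 ≤ m) (c : Fin m → ℂ)
    (hc : IsQuiddityCycle c) (hne : ∃ k, c k ≠ 0) :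
    (IsFriezePattern (m - 3) (friezeOf c) ∧ IsTame (m - 3) (friezeOf c)) ∧
    (∃ T, IsCluster m T ∧ NonzeroOn (friezeOf c) T) ∧
    IsSpecialization (m - 3) (friezeOf c) := by
  have hF := hc.isFriezePattern hm
  have hT := hc.exists_cluster hne
  refine ⟨⟨hF, friezeOf_isTame c _⟩, hT, hF, friezeOf_isTame c _, ?_⟩
  rwa [Nat.sub_add_cancel (by omega : 3 ≤ m)]
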